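/- For $n\ge 0$ let $\mathfrak S_n$ be the set of permutations of $[n]=\{1,\dots,n\}$. For $\pi\in\mathfrak S_n$, let $\mathrm{basc}(\pi)$, $\mathrm{des}(\pi)$ and $\mathrm{suc}(\pi)$ be the numbers of indices $i\in[n-1]$ with $\pi(i+1)\ge\pi(i)+2$, $\pi(i)>\pi(i+1)$ and $\pi(i+1)=\pi(i)+1$ respectively, and let $\mathrm{fix}(\pi)$ and $\mathrm{exc}(\pi)$ be the numbers of indices $i\in[n]$ with $\pi(i)=i$ and $\pi(i)>i$ respectively. Put $$A_n(x,y,s)=\sum_{\pi\in\mathfrak S_n}x^{\mathrm{basc}(\pi)}y^{\mathrm{des}(\pi)}s^{\mathrm{suc}(\pi)}.$$ A cycle double ascent of $\pi$ is a value $a$ with $\pi^{-1}(a)<a<\pi(a)$. Call $\pi\in\mathfrak S_n$ a simsun permutation of the second kind if, for every $0\le k\le n$, the permutation of $[n-k]$ obtained by deleting the $k$ largest letters from the cycle notation of $\pi$ has no cycle double ascents; let $\mathcal{SS}_n$ be the set of these permutations. **Theorem.** As formal power series in $z$ over the field $\mathbb Q(x,y,s)$, $$\sum_{n\ge 0}A_{n+1}(x,y,s)\frac{z^n}{n!}=e^{z(y+s)}\left(\frac{y-x}{ye^{xz}-xe^{yz}}\right)^2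 .$$ Moreover, there are integers $\gamma_{n,i,j}$ ($n\ge 0$; $i,j\in\mathbb Z$) such that for all $n\ge 0$ $$A_{n+1}(x,y,s)=\sum_{i=0}^n(s+y)^i\sum_{j=0}^{\lfloor (n-i)/2\rfloor}2^j\gamma_{n,i,j}(xy)^j(x+y)^{n-i-2j};$$ they satisfy, for all $n\ge 0$ and all integers $i,j$, the recurrence $$\gamma_{n+1,i,j}=\gamma_{n,i-1,j}+(1+i)\gamma_{n,i+1,j-1}+j\,\gamma_{n,i,j}+(n-i-2j+2)\gamma_{n,i,j-1}$$ with the initial conditions $\gamma_{0,0,0}=1$ and $\gamma_{0,i,j}=0$ for $(i,j)\ne(0,0)$; and $$\gamma_{n,i,j}=\#\{\pi\in\mathcal{SS}_n:\ \mathrm{fix}(\pi)=i,\ \mathrm{exc}(\pi)=j\}.$$ -/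

import Mathlib

namespace PermStat

open Equiv

/-! Permutations of `[n]` are modelled by `Perm (Fin n)`: position `i` and value `π i` are shifted
down by one, which changes none of the statistics below. -/

/-- Number of big ascents: positions `i` with `i + 1` a position and `π (i+1) ≥ π i + 2`. -/
def basc {n : ℕ} (π : Perm (Fin n)) : ℕ :=
  (Finset.univ.filter fun i : Fin n =>
    ∃ h : (i : ℕ) + 1 < n, (π ⟨(i : ℕ) + 1, h⟩ : ℕ) ≥ (π i : ℕ) + 2).card

/-- Number of descents: positions `i` with `i + 1` a position and `π i > π (i+1)`. -/
def des {n : ℕ} (π : Perm (Fin n)) : ℕ :=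
  (Finset.univ.filter fun i : Fin n =>
    ∃ h : (i : ℕ) + 1 < n, π i > π ⟨(i : ℕ) + 1, h⟩).card

/-- Number of successions: positions `i` with `i + 1` a position and `π (i+1) = π i + 1`
(equality of natural numbers, without wrap-around). -/
def suc {n : ℕ} (π : Perm (Fin n)) : ℕ :=
  (Finset.univ.filter fun i : Fin n =>
    ∃ h : (i : ℕ) + 1 < n, (π ⟨(i : ℕ) + 1, h⟩ : ℕ) = (π i : ℕ) + 1).card

/-- Number of fixed points. -/
def fix {n : ℕ} (π : Perm (Fin n)) : ℕ :=
  (Finset.univ.filter fun i : Fin n => π i = i).card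

/-- Number of excedances. -/
def exc {n : ℕ} (π : Perm (Fin n)) : ℕ :=
  (Finset.univ.filter fun i : Fin n => π i > i).card

/-- Number of cycle double ascents: values `a` with `π⁻¹ a < a < π a`. -/
def cda {n : ℕ} (π : Perm (Fin n)) : ℕ :=
  (Finset.univ.filter fun a : Fin n => π⁻¹ a < a ∧ a < π a).card

/-- Remove the largest letter from the cycle notation of a permutation: the predecessor of the
largest letter is now sent to the image of the largest letter, all other images are unchanged. -/
def removeMax {n : ℕ} (π : Perm (Fin (n + 1))) : Perm (Fin n) :=
  Equiv.removeNone (finSuccEquivLast.permCongr π)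

/-- Remove the `k` largest letters from the cycle notation of a permutation. -/
def removeLargest {m : ℕ} : (k : ℕ) → Perm (Fin (m + k)) → Perm (Fin m)
  | 0, π => π
  | k + 1, π => removeLargest k (removeMax (n := m + k) π)

/-- Simsun permutations of the second kind: for every `0 ≤ k ≤ n`, removing the `k` largest letters
(so that `m = n - k` letters remain) leaves a permutation without cycle double ascents. -/
def IsSimsunSecond {n : ℕ} (π : Perm (Fin n)) : Prop :=
  ∀ (m k : ℕ) (h : n = m + k), cda (removeLargest k ((finCongr h).permCongr π)) = 0

/-- The polynomial ring `ℚ[x, y, s]`. -/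
abbrev Poly : Type := MvPolynomial (Fin 3) ℚ

/-- The indeterminate `x`. -/
noncomputable def x : Poly := MvPolynomial.X 0

/-- The indeterminate `y`. -/
noncomputable def y : Poly := MvPolynomial.X 1

/-- The indeterminate `s`. -/
noncomputable def s : Poly := MvPolynomial.X 2

/-- `A n = ∑ x ^ basc π * y ^ des π * s ^ suc π`, summed over all permutations `π` of `[n]`. -/
noncomputable def A (n : ℕ) : Poly :=
  ∑ π : Perm (Fin n), x ^ basc π * y ^ des π * s ^ suc π

/-- The field `ℚ(x, y, s)` of rational functions. -/
abbrev RatFun : Type := FractionRing Poly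

/-- A polynomial seen as a constant power series in `z` over `ℚ(x, y, s)`. -/
noncomputable def const (p : Poly) : PowerSeries RatFun :=
  PowerSeries.C (algebraMap Poly RatFun p)

/-- The power series `e^{p z} = ∑ pⁿ zⁿ / n!` in `z` over `ℚ(x, y, s)`. -/
noncomputable def expz (p : Poly) : PowerSeries RatFun :=
  PowerSeries.rescale (algebraMap Poly RatFun p) (PowerSeries.exp RatFun)

/-- The exponential generating function `∑ A_{n+1}(x,y,s) zⁿ / n!`. -/
noncomputable def egf : PowerSeries RatFun :=
  PowerSeries.mk fun n => algebraMap Poly RatFun (A (n + 1)) / (n.factorial : RatFun)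

/-- The denominator `y e^{xz} - x e^{yz}` has constant coefficient `y - x ≠ 0`, so that it is
invertible as a power series over `ℚ(x, y, s)`. -/
theorem constantCoeff_denominator_ne_zero :
    PowerSeries.constantCoeff (const y * expz x - const x * expz y) ≠ 0 := by
  have h : y - x ≠ 0 := by
    rw [sub_ne_zero]
    intro h
    have := MvPolynomial.X_injective (R := ℚ) h
    exact absurd this (by decide)
  have h2 : algebraMap Poly RatFun (y - x) ≠ 0 := by
    simpa using (map_ne_zero_iff (algebraMap Poly RatFun)
      (IsFractionRing.injective Poly RatFun)).2 h
  have h3 (p : Poly) : PowerSeries.constantCoeff (expz p) = 1 := by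
    rw [← PowerSeries.coeff_zero_eq_constantCoeff_apply, expz, PowerSeries.coeff_rescale,
      PowerSeries.coeff_exp]
    simp
  rw [map_sub, map_mul, map_mul, h3, h3, mul_one, mul_one, const, const,
    PowerSeries.constantCoeff_C, PowerSeries.constantCoeff_C, ← map_sub]
  exact h2

end PermStat

/-! ### The differential equation for the generating function -/

namespace PermStat
open PowerSeries

/-! Everything rests on one recurrence, `A_succ_succ`: with D = ∂/∂x + ∂/∂y + ∂/∂s, A_{n+2} = (s+y)
A_{n+1} + xy D A_{n+1}. It comes from inserting a new largest letter into a word: a gap of weight x,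
y or s becomes an ascent and a descent, of weight xy, and D deletes one factor at a time. Only the
front (y) and the old maximum (s) behave differently.

Summed over n, this is a linear equation G' = (s+y)G + xy DG, whose solution is determined by its
constant term. `polyEgf_mul_sq` checks the closed form after clearing the denominator.

For the expansion, the new letter is inserted into cycle notation instead. Simsun permutations grow
by a new fixed point, or by insertion after a fixed point, an excedance or a cycle double descent
(`sum_simsun_succ`). Giving these three the weights s+y, 2xy and x+y, the operator (s+y) + xy D
reproduces this growth (`gammaWeight_recurrence`), so the weighted sum obeys the recurrence of A.
Counting the same growth gives the recurrence of γ. -/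

/-- The derivation `∂/∂x + ∂/∂y + ∂/∂s` of `ℚ[x, y, s]`. -/
noncomputable def diagDeriv : Derivation ℚ Poly Poly :=
  MvPolynomial.mkDerivation ℚ fun _ => 1

@[simp] theorem diagDeriv_x : diagDeriv x = 1 := MvPolynomial.mkDerivation_X _ _ _

@[simp] theorem diagDeriv_y : diagDeriv y = 1 := MvPolynomial.mkDerivation_X _ _ _

@[simp] theorem diagDeriv_s : diagDeriv s = 1 := MvPolynomial.mkDerivation_X _ _ _

/-- A derivation of the coefficient ring, applied to each coefficient of a power series. -/
noncomputable def coeffDeriv {R : Type*} [CommRing R] [Algebra ℚ R] (D : Derivation ℚ R R) :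
    Derivation ℚ (PowerSeries R) (PowerSeries R) :=
  Derivation.mk'
    { toFun := fun f => PowerSeries.mk fun n => D (coeff n f)
      map_add' := fun f g => by ext n; simp
      map_smul' := fun c f => by ext n; simp }
    (fun f g => by
      ext n
      simp only [LinearMap.coe_mk, AddHom.coe_mk, coeff_mk, smul_eq_mul, map_add, coeff_mul,
        map_sum, Derivation.leibniz, Finset.sum_add_distrib]
      congr 1
      exact Finset.Nat.sum_antidiagonal_swap
        (f := fun p : ℕ × ℕ => coeff p.1 g * D (coeff p.2 f)))

section

variable {R : Type*} [CommRing R] [Algebra ℚ R] (D : Derivation ℚ R R)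

theorem coeff_coeffDeriv (f : PowerSeries R) (n : ℕ) :
    coeff n (coeffDeriv D f) = D (coeff n f) := by
  simp [coeffDeriv]

theorem coeffDeriv_C (r : R) : coeffDeriv D (C r) = C (D r) := by
  ext n
  rw [coeff_coeffDeriv, coeff_C, coeff_C]
  split_ifs <;> simp

theorem coeffDeriv_rescale_exp (p : R) :
    coeffDeriv D (rescale p (exp R)) = C (D p) * X * rescale p (exp R) := by
  ext n
  rw [coeff_coeffDeriv, mul_assoc, coeff_C_mul]
  cases n with
  | zero => simp
  | succ n =>
    rw [coeff_succ_X_mul, coeff_rescale, coeff_rescale, coeff_exp, coeff_exp, mul_comm,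
      ← Algebra.smul_def, Derivation.map_smul, Derivation.leibniz_pow, Nat.add_sub_cancel, smul_eq_mul,
      Nat.factorial_succ, ← Nat.cast_smul_eq_nsmul ℚ, smul_smul, mul_comm (p ^ n),
      mul_comm (D p) (p ^ n), ← mul_assoc (D p), mul_comm _ (algebraMap ℚ R _), ← Algebra.smul_def,
      mul_comm (D p)]
    congr 1
    have : (n.factorial : ℚ) ≠ 0 := by positivity
    push_cast
    field_simp

theorem derivative_rescale_exp (p : R) :
    d⁄dX R (rescale p (exp R)) = C p * rescale p (exp R) := by
  ext n
  rw [coeff_derivative, coeff_C_mul, coeff_rescale, coeff_rescale, coeff_exp, coeff_exp]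
  have h : algebraMap ℚ R (1 / (n + 1).factorial) * ((n : R) + 1) =
      algebraMap ℚ R (1 / n.factorial) := by
    have : ((n : R) + 1) = algebraMap ℚ R (n + 1) := by simp
    rw [this, ← map_mul, Nat.factorial_succ]
    congr 1
    have : (n.factorial : ℚ) ≠ 0 := by positivity
    push_cast
    field_simp
  rw [mul_assoc, h, pow_succ]
  ring

/-- Uniqueness for a first order linear differential equation in `z`. -/
theorem eq_of_derivative_eq {u v : PowerSeries R} {G H : PowerSeries R}
    (h0 : constantCoeff G = constantCoeff H)
    (hG : d⁄dX R G = u * G + v * coeffDeriv D G)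
    (hH : d⁄dX R H = u * H + v * coeffDeriv D H) : G = H := by
  have key : ∀ n, ∀ m ≤ n, coeff m G = coeff m H := by
    intro n
    induction n with
    | zero =>
      intro m hm
      obtain rfl : m = 0 := by omega
      simpa using h0
    | succ n ih =>
      intro m hm
      rcases Nat.lt_or_ge m (n + 1) with h | h
      · exact ih m (by omega)
      obtain rfl : m = n + 1 := by omega
      -- The derivation acts coefficientwise, so the equation expresses (n+1) times coefficient n+1
      -- through coefficients of index at most n; n+1 is a unit over ℚ.
      have h1 : coeff n (d⁄dX R G) = coeff n (d⁄dX R H) := by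
        rw [hG, hH, map_add, map_add, coeff_mul, coeff_mul, coeff_mul, coeff_mul]
        congr 1
        · refine Finset.sum_congr rfl fun p hp => ?_
          rw [ih p.2 (by have := Finset.HasAntidiagonal.mem_antidiagonal.1 hp; omega)]
        · refine Finset.sum_congr rfl fun p hp => ?_
          rw [coeff_coeffDeriv, coeff_coeffDeriv, ih p.2 (by have := Finset.HasAntidiagonal.mem_antidiagonal.1 hp; omega)]
      rw [coeff_derivative, coeff_derivative] at h1
      have h2 : IsUnit ((n : R) + 1) := by
        have : ((n : R) + 1) = algebraMap ℚ R (n + 1) := by simp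
        rw [this]
        exact (IsUnit.mk0 _ (by positivity)).map _
      exact h2.mul_right_cancel h1
  ext n
  exact key n n le_rfl

end

/-- The exponential generating function of the sequence `B` of polynomials. -/
noncomputable def polyEgf (B : ℕ → Poly) : PowerSeries Poly :=
  PowerSeries.mk fun n => (1 / n.factorial : ℚ) • B n

theorem derivative_polyEgf {B : ℕ → Poly}
    (hB : ∀ n, B (n + 1) = (s + y) * B n + x * y * diagDeriv (B n)) :
    d⁄dX Poly (polyEgf B) =
      C (s + y) * polyEgf B + C (x * y) * coeffDeriv diagDeriv (polyEgf B) := by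
  ext1 n
  rw [coeff_derivative, map_add, coeff_C_mul, coeff_C_mul, coeff_coeffDeriv, polyEgf, coeff_mk,
    coeff_mk, hB, Derivation.map_smul, mul_smul_comm, mul_smul_comm, ← smul_add]
  have : ((n : Poly) + 1) = algebraMap ℚ Poly (n + 1) := by simp
  rw [this, mul_comm, ← Algebra.smul_def, smul_smul, Nat.factorial_succ]
  congr 1
  have : (n.factorial : ℚ) ≠ 0 := by positivity
  push_cast
  field_simp

theorem polyEgf_mul_sq {B : ℕ → Poly} (h0 : B 0 = 1)
    (hB : ∀ n, B (n + 1) = (s + y) * B n + x * y * diagDeriv (B n)) :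
    polyEgf B * (C y * rescale x (exp Poly) - C x * rescale y (exp Poly)) ^ 2 =
      rescale (y + s) (exp Poly) * C (y - x) ^ 2 := by
  -- Let Q = y e^{xz} - x e^{yz}. Then Q' = xy(e^{xz} - e^{yz}) and DQ = e^{xz} - e^{yz} + zQ, so Q'
  -- - xy DQ = -xyzQ; the square doubles this. On the right, D(y+s) = 2 and D(y-x) = 0 give the same
  -- `u`.
  refine eq_of_derivative_eq diagDeriv (u := C (s + y) - 2 * C (x * y) * X) (v := C (x * y))
    ?_ ?_ ?_
  · have hE (p : Poly) : constantCoeff (rescale p (exp Poly)) = 1 := by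
      rw [← coeff_zero_eq_constantCoeff_apply, coeff_rescale, coeff_exp]
      simp
    simp [polyEgf, h0, hE]
  · simp only [Derivation.leibniz, Derivation.leibniz_pow, map_sub, smul_eq_mul,
      derivative_rescale_exp, coeffDeriv_rescale_exp, derivative_polyEgf hB, derivative_C,
      coeffDeriv_C, diagDeriv_x, diagDeriv_y, map_one, map_mul, map_add]
    simp
    ring
  · simp only [Derivation.leibniz, Derivation.leibniz_pow, map_sub, smul_eq_mul,
      derivative_rescale_exp, coeffDeriv_rescale_exp, derivative_C,
      coeffDeriv_C, diagDeriv_x, diagDeriv_y, diagDeriv_s, map_one, map_mul, map_add]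
    simp
    ring

theorem egf_eq (h : ∀ n, A (n + 2) = (s + y) * A (n + 1) + x * y * diagDeriv (A (n + 1)))
    (h1 : A 1 = 1) :
    egf = expz (y + s) * (const (y - x) * (const y * expz x - const x * expz y)⁻¹) ^ 2 := by
  have key := congrArg (PowerSeries.map (algebraMap Poly RatFun))
    (polyEgf_mul_sq (B := fun n => A (n + 1)) h1 h)
  have hE (p : Poly) :
      PowerSeries.map (algebraMap Poly RatFun) (rescale p (exp Poly)) = expz p := by
    ext n
    rw [coeff_map, coeff_rescale, coeff_exp, expz, coeff_rescale, coeff_exp, map_mul, map_pow,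
      ← IsScalarTower.algebraMap_apply ℚ Poly RatFun]
  have hF : PowerSeries.map (algebraMap Poly RatFun) (polyEgf fun n => A (n + 1)) = egf := by
    ext n
    rw [coeff_map, polyEgf, egf, coeff_mk, coeff_mk, Algebra.smul_def, map_mul,
      div_eq_inv_mul (algebraMap Poly RatFun _)]
    congr 1
    rw [← IsScalarTower.algebraMap_apply ℚ Poly RatFun]
    simp
  simp only [map_mul, map_pow, map_sub, hE, hF, PowerSeries.map_C] at key
  have hc (p : Poly) : C (algebraMap Poly RatFun p) = const p := rfl
  rw [← map_sub, ← map_sub, hc, hc, hc] at key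
  rw [mul_pow, ← mul_assoc, ← key, mul_assoc, ← mul_pow,
    PowerSeries.mul_inv_cancel _ constantCoeff_denominator_ne_zero, one_pow, mul_one]

end PermStat

/-! ### Inserting the largest letter into a word -/

namespace PermStat

/-- The weight of a pair of adjacent letters of a word. -/
noncomputable def pairWeight (a b : ℕ) : Poly :=
  if b ≥ a + 2 then x else if b = a + 1 then s else y

/-- The product of the weights of the pairs of adjacent letters of a word. -/
noncomputable def wordWeight {n : ℕ} (f : Fin n → ℕ) : Poly :=
  ∏ i : Fin n, if h : (i : ℕ) + 1 < n then pairWeight (f i) (f ⟨(i : ℕ) + 1, h⟩) else 1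

theorem pairWeight_of_gt {a b : ℕ} (h : b < a) : pairWeight a b = y := by
  rw [pairWeight, if_neg (by omega), if_neg (by omega)]

/-- By Leibniz, D of a word's weight is therefore the sum, over adjacent pairs, of the weight with
that pair's factor deleted. -/
theorem diagDeriv_pairWeight (a b : ℕ) : diagDeriv (pairWeight a b) = 1 := by
  unfold pairWeight
  split_ifs <;> simp

theorem wordWeight_cons {n : ℕ} (a : ℕ) (f : Fin (n + 1) → ℕ) :
    wordWeight (Fin.cons a f : Fin (n + 2) → ℕ) = pairWeight a (f 0) * wordWeight f := by
  rw [wordWeight, Fin.prod_univ_succ, dif_pos (by simp)]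
  refine congrArg (_ * ·) (Finset.prod_congr rfl fun i _ => ?_)
  by_cases h : (i : ℕ) + 1 < n + 1
  · rw [dif_pos h, dif_pos (by simpa using h)]
    rfl
  · rw [dif_neg h, dif_neg (by simpa using h)]

theorem wordWeight_of_le_one {n : ℕ} (hn : n ≤ 1) (f : Fin n → ℕ) : wordWeight f = 1 :=
  Finset.prod_eq_one fun i _ => dif_neg (by omega)

theorem insertNth_succ_cons {α : Type*} {n : ℕ} (p : Fin (n + 1)) (N a : α) (f : Fin n → α) :
    (p.succ.insertNth (α := fun _ => α) N (Fin.cons a f : Fin (n + 1) → α) : Fin (n + 2) → α) =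
      Fin.cons a (p.insertNth (α := fun _ => α) N f) := by
  symm
  rw [Fin.eq_insertNth_iff]
  refine ⟨by simp, funext fun j => ?_⟩
  refine Fin.cases ?_ (fun j => ?_) j
  · simp [Fin.removeNth]
  · simp [Fin.removeNth]

-- Inside a gap (a, b) the factor w(a, b) becomes w(a, M+1)·y, which is xy unless a = M; at the end
-- the new factor is x unless the last letter is M. If M is followed by b, then w(M, b) = y and the
-- gap yields s times the old weight instead of x times it. So M changes one x into s wherever it
-- stands. The front position is left out, and M need not occur, so that the induction can pass to
-- tails.
open Classical in
theorem sum_wordWeight_insertNth_succ {n : ℕ} (M : ℕ) (f : Fin (n + 1) → ℕ)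
    (hf : Function.Injective f) (hM : ∀ i, f i ≤ M) :
    ∑ p : Fin (n + 1), wordWeight (p.succ.insertNth (α := fun _ => ℕ) (M + 1) f) =
      x * y * diagDeriv (wordWeight f) + (if ∃ i, f i = M then s else x) * wordWeight f := by
  induction n with
  | zero =>
    have h1 : f = Fin.cons (f 0) (fun i => i.elim0) := by
      ext i
      rw [Fin.fin_one_eq_zero i]
      rfl
    have hex : (∃ i, f i = M) ↔ f 0 = M :=
      ⟨fun ⟨i, hi⟩ => Fin.fin_one_eq_zero i ▸ hi, fun h => ⟨0, h⟩⟩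
    simp only [hex]
    rw [Fin.sum_univ_one, wordWeight_of_le_one le_rfl, Derivation.map_one_eq_zero, h1, insertNth_succ_cons,
      Fin.insertNth_zero', wordWeight_cons, wordWeight_of_le_one le_rfl]
    have := hM 0
    simp only [Fin.cons_zero, pairWeight, mul_zero, zero_add, mul_one]
    split_ifs <;> first | rfl | omega
  | succ n ih =>
    obtain ⟨a, g, rfl⟩ : ∃ a g, f = Fin.cons a g := ⟨_, _, (Fin.cons_self_tail f).symm⟩
    have ha := hM 0
    have hg : ∀ i, g i ≤ M := fun i => by simpa using hM i.succ
    have hag : ∀ i, a ≠ g i := fun i h => Fin.succ_ne_zero i (hf (by simpa using h.symm))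
    have hgi : Function.Injective g := (Fin.cons_injective_iff.1 hf).2
    rw [Fin.cons_zero] at ha
    have hsum : ∀ p : Fin (n + 1),
        wordWeight (p.succ.succ.insertNth (α := fun _ => ℕ) (M + 1) (Fin.cons a g)) =
          pairWeight a (g 0) * wordWeight (p.succ.insertNth (α := fun _ => ℕ) (M + 1) g) := by
      intro p
      rw [insertNth_succ_cons, wordWeight_cons]
      congr 2
    rw [Fin.sum_univ_succ, Finset.sum_congr rfl fun p _ => hsum p, ← Finset.mul_sum,
      ih g hgi hg, insertNth_succ_cons, Fin.insertNth_zero', wordWeight_cons, wordWeight_cons,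
      wordWeight_cons, Fin.cons_zero, pairWeight_of_gt (Nat.lt_succ_of_le (hg 0)),
      Derivation.leibniz, diagDeriv_pairWeight]
    have hex : (∃ i, (Fin.cons a g : Fin (n + 2) → ℕ) i = M) ↔ a = M ∨ ∃ i, g i = M := by
      rw [Fin.exists_fin_succ]
      rfl
    simp only [hex, smul_eq_mul]
    by_cases h : a = M
    · have h2 : ¬ ∃ i, g i = M := fun ⟨i, hi⟩ => hag i (h.trans hi.symm)
      have h3 : g 0 < a := lt_of_le_of_ne (h ▸ hg 0) (hag 0).symm
      have h4 : pairWeight a (M + 1) = s := by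
        rw [pairWeight, if_neg (by omega), if_pos (by omega)]
      rw [if_neg h2, if_pos (Or.inl h), pairWeight_of_gt h3, h4]
      ring
    · have h4 : pairWeight a (M + 1) = x := by
        rw [pairWeight, if_pos (by omega)]
      simp only [h, false_or, h4]
      ring

theorem sum_wordWeight_insertNth {n : ℕ} (f : Fin (n + 1) → ℕ) (hf : Function.Injective f)
    (hM : ∀ i, f i ≤ n) :
    ∑ p : Fin (n + 2), wordWeight (p.insertNth (α := fun _ => ℕ) (n + 1) f) =
      (s + y) * wordWeight f + x * y * diagDeriv (wordWeight f) := by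
  have h : ∃ i, f i = n := by
    have hinj : Function.Injective fun i => (⟨f i, Nat.lt_succ_of_le (hM i)⟩ : Fin (n + 1)) :=
      fun i j hij => hf (congrArg Fin.val hij)
    obtain ⟨i, hi⟩ := (Finite.surjective_of_injective hinj) (Fin.last n)
    exact ⟨i, congrArg Fin.val hi⟩
  rw [Fin.sum_univ_succ, sum_wordWeight_insertNth_succ n f hf hM, if_pos h, Fin.insertNth_zero',
    wordWeight_cons, pairWeight_of_gt (Nat.lt_succ_of_le (hM 0))]
  ring

theorem weight_eq_wordWeight {n : ℕ} (π : Equiv.Perm (Fin n)) :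
    x ^ basc π * y ^ des π * s ^ suc π = wordWeight fun i => (π i : ℕ) := by
  have hpow (a : Poly) (p : Fin n → Prop) [DecidablePred p] :
      a ^ (Finset.univ.filter p).card = ∏ i, if p i then a else 1 := by
    rw [Finset.prod_ite, Finset.prod_const, Finset.prod_const_one, mul_one]
  rw [basc, des, suc, hpow, hpow, hpow, ← Finset.prod_mul_distrib, ← Finset.prod_mul_distrib,
    wordWeight]
  refine Finset.prod_congr rfl fun i _ => ?_
  by_cases h : (i : ℕ) + 1 < n
  · have hne : (π i : ℕ) ≠ π ⟨(i : ℕ) + 1, h⟩ := fun he => by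
      have := congrArg Fin.val (π.injective (Fin.ext he))
      simp at this
    simp only [h, exists_true_left, dif_pos, pairWeight, gt_iff_lt, Fin.lt_def]
    split_ifs <;> first | omega | simp
  · simp [h]

/-- Insertion of a new largest letter at position `p` of the word of a permutation. -/
noncomputable def insertLargest {n : ℕ} (p : Fin (n + 1)) (π : Equiv.Perm (Fin n)) :
    Equiv.Perm (Fin (n + 1)) :=
  (finSuccEquiv' p).trans (π.optionCongr.trans finSuccEquivLast.symm)

theorem insertLargest_val {n : ℕ} (p : Fin (n + 1)) (π : Equiv.Perm (Fin n)) :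
    (fun i => (insertLargest p π i : ℕ)) =
      p.insertNth (α := fun _ => ℕ) n fun i => (π i : ℕ) := by
  rw [Fin.eq_insertNth_iff]
  refine ⟨by simp [insertLargest], funext fun j => ?_⟩
  simp [insertLargest, Fin.removeNth]

/-- The position of the largest letter recovers `p`, and the remaining letters recover `π`;
surjectivity follows by counting. -/
theorem insertLargest_bijective (n : ℕ) :
    Function.Bijective fun q : Fin (n + 1) × Equiv.Perm (Fin n) => insertLargest q.1 q.2 := by
  rw [Fintype.bijective_iff_injective_and_card]
  constructor
  · rintro ⟨p, π⟩ ⟨q, τ⟩ h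
    have hp : insertLargest p π p = Fin.last n := by simp [insertLargest]
    have hq : insertLargest q τ q = Fin.last n := by simp [insertLargest]
    simp only at h
    obtain rfl : p = q := (insertLargest p π).injective (by rw [hp, h, hq])
    have h2 := (insertLargest_val p π).symm.trans (h ▸ insertLargest_val p τ)
    have h3 := Fin.insertNth_right_injective (α := fun _ => ℕ) (p := p) _ h2
    rw [Equiv.ext fun i => Fin.ext (congrFun h3 i)]
  · simp [Fintype.card_perm, Nat.factorial_succ]

theorem A_one : A 1 = 1 := by
  simp [A, weight_eq_wordWeight, wordWeight_of_le_one]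

theorem A_succ_succ (n : ℕ) :
    A (n + 2) = (s + y) * A (n + 1) + x * y * diagDeriv (A (n + 1)) := by
  simp only [A, weight_eq_wordWeight]
  rw [← (insertLargest_bijective (n + 1)).sum_comp, Fintype.sum_prod_type_right, map_sum,
    Finset.mul_sum, Finset.mul_sum, ← Finset.sum_add_distrib]
  refine Finset.sum_congr rfl fun π _ => ?_
  simp only [insertLargest_val]
  exact sum_wordWeight_insertNth _ (Fin.val_injective.comp π.injective)
    fun i => Nat.le_of_lt_succ (π i).isLt

end PermStat

/-! ### Inserting the largest letter into cycle notation -/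

namespace PermStat
open Equiv

theorem apply_inv_self {α : Type*} (π : Perm α) (a : α) : π (π⁻¹ a) = a :=
  π.apply_symm_apply a

theorem isSimsunSecond_zero (π : Perm (Fin 0)) : IsSimsunSecond π := by
  intro m k h
  obtain rfl : m = 0 := by omega
  simp [cda]

theorem isSimsunSecond_iff {n : ℕ} (π : Perm (Fin (n + 1))) :
    IsSimsunSecond π ↔ cda π = 0 ∧ IsSimsunSecond (removeMax π) := by
  constructor
  · intro h
    refine ⟨h (n + 1) 0 rfl, fun m k hk => ?_⟩
    subst hk
    exact h m (k + 1) rfl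
  · rintro ⟨h0, h⟩ m k hk
    cases k with
    | zero =>
      obtain rfl : m = n + 1 := by omega
      exact h0
    | succ k =>
      obtain rfl : n = m + k := by omega
      exact h m k rfl

theorem IsSimsunSecond.cda_eq_zero {n : ℕ} {π : Perm (Fin n)} (h : IsSimsunSecond π) :
    cda π = 0 :=
  h n 0 rfl

theorem cda_eq_zero_iff {n : ℕ} (π : Perm (Fin n)) :
    cda π = 0 ↔ ∀ i, i < π i → ¬ π i < π (π i) := by
  rw [cda, Finset.card_eq_zero, Finset.filter_eq_empty_iff]
  constructor
  · intro h i h1 h2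
    exact h (Finset.mem_univ (π i)) ⟨by simpa using h1, h2⟩
  · rintro h a - ⟨h1, h2⟩
    exact h (π⁻¹ a) (by simpa using h1) (by simpa using h2)

/-- Insertion of a new largest letter into the cycle notation of a permutation: either after the
letter `a`, or as a new fixed point. -/
def cycleInsert {n : ℕ} (π : Perm (Fin n)) (o : Option (Fin n)) : Perm (Fin (n + 1)) :=
  -- The inverse of `Perm.decomposeOption` applies a swap with `none` after `π`; swapping with `π a`
  -- sends `a` to the new letter and the new letter to `π a`.
  finSuccEquivLast.symm.permCongr (Perm.decomposeOption.symm (o.map π, π))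

theorem removeMax_cycleInsert {n : ℕ} (π : Perm (Fin n)) (o : Option (Fin n)) :
    removeMax (cycleInsert π o) = π := by
  have h := Perm.decomposeOption.apply_symm_apply (o.map π, π)
  have h2 : finSuccEquivLast.permCongr (cycleInsert π o) =
      Perm.decomposeOption.symm (o.map π, π) :=
    (finSuccEquivLast.permCongr).apply_symm_apply _
  rw [removeMax, h2]
  exact congrArg Prod.snd h

theorem sum_perm_fin_succ {n : ℕ} {M : Type*} [AddCommMonoid M] (F : Perm (Fin (n + 1)) → M) :
    ∑ σ, F σ = ∑ π, (F (cycleInsert π none) + ∑ a, F (cycleInsert π (some a))) := by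
  rw [← (Perm.decomposeOption.symm.trans
    (finSuccEquivLast (n := n)).symm.permCongr).sum_comp, Fintype.sum_prod_type_right]
  refine Finset.sum_congr rfl fun π _ => ?_
  rw [← π.optionCongr.sum_comp, Fintype.sum_option]
  rfl

theorem cycleInsert_none_castSucc {n : ℕ} (π : Perm (Fin n)) (i : Fin n) :
    cycleInsert π none i.castSucc = (π i).castSucc := by
  simp [cycleInsert, permCongr_apply]

theorem cycleInsert_none_last {n : ℕ} (π : Perm (Fin n)) :
    cycleInsert π none (Fin.last n) = Fin.last n := by
  simp [cycleInsert, permCongr_apply]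

theorem cycleInsert_some_self {n : ℕ} (π : Perm (Fin n)) (a : Fin n) :
    cycleInsert π (some a) a.castSucc = Fin.last n := by
  simp [cycleInsert, permCongr_apply]

theorem cycleInsert_some_of_ne {n : ℕ} (π : Perm (Fin n)) {a i : Fin n} (h : i ≠ a) :
    cycleInsert π (some a) i.castSucc = (π i).castSucc := by
  simp [cycleInsert, permCongr_apply, swap_apply_of_ne_of_ne, h]

theorem cycleInsert_some_last {n : ℕ} (π : Perm (Fin n)) (a : Fin n) :
    cycleInsert π (some a) (Fin.last n) = (π a).castSucc := by
  simp [cycleInsert, permCongr_apply]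

theorem isSimsunSecond_cycleInsert_none {n : ℕ} (π : Perm (Fin n)) :
    IsSimsunSecond (cycleInsert π none) ↔ IsSimsunSecond π := by
  rw [isSimsunSecond_iff, removeMax_cycleInsert, and_iff_right_of_imp]
  intro h
  have h0 := (cda_eq_zero_iff π).1 h.cda_eq_zero
  rw [cda_eq_zero_iff]
  intro i
  refine Fin.lastCases ?_ (fun i => ?_) i
  · simp [cycleInsert_none_last]
  · simpa [cycleInsert_none_castSucc] using h0 i

/-- Only `a` can become a double ascent, since its image is now the largest letter. The new letter
is too large to be one, and so is the predecessor of the old image `π a`. -/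
theorem isSimsunSecond_cycleInsert_some {n : ℕ} (π : Perm (Fin n)) (a : Fin n) :
    IsSimsunSecond (cycleInsert π (some a)) ↔ IsSimsunSecond π ∧ ¬ π⁻¹ a < a := by
  rw [isSimsunSecond_iff, removeMax_cycleInsert, and_comm, and_congr_right_iff]
  intro h
  have h0 := (cda_eq_zero_iff π).1 h.cda_eq_zero
  rw [cda_eq_zero_iff]
  constructor
  · intro h1 h2
    have h3 := h1 (π⁻¹ a).castSucc
    rw [cycleInsert_some_of_ne π h2.ne, apply_inv_self, cycleInsert_some_self] at h3
    exact h3 (Fin.castSucc_lt_castSucc_iff.2 h2) (Fin.castSucc_lt_last a)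
  · intro h1 i
    refine Fin.lastCases ?_ (fun i => ?_) i
    · simp [cycleInsert_some_last, Fin.le_last]
    · by_cases hi : i = a
      · subst hi
        simp [cycleInsert_some_self, Fin.le_last]
      · rw [cycleInsert_some_of_ne π hi]
        by_cases hi2 : π i = a
        · have h3 : i = π⁻¹ a := by rw [← hi2, Perm.inv_def, symm_apply_apply]
          intro h4
          rw [hi2, Fin.castSucc_lt_castSucc_iff, h3] at h4
          exact absurd h4 h1
        · rw [cycleInsert_some_of_ne π hi2]
          simpa using h0 i

theorem fix_cycleInsert_none {n : ℕ} (π : Perm (Fin n)) :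
    fix (cycleInsert π none) = fix π + 1 := by
  simp [fix, Finset.card_filter, Fin.sum_univ_castSucc, cycleInsert_none_castSucc,
    cycleInsert_none_last, -Finset.sum_boole]

theorem exc_cycleInsert_none {n : ℕ} (π : Perm (Fin n)) :
    exc (cycleInsert π none) = exc π := by
  simp [exc, Finset.card_filter, Fin.sum_univ_castSucc, cycleInsert_none_castSucc,
    cycleInsert_none_last, -Finset.sum_boole]

/-- The correction stands on the left to avoid truncated subtraction. -/
theorem fix_cycleInsert_some {n : ℕ} (π : Perm (Fin n)) (a : Fin n) :
    fix (cycleInsert π (some a)) + (if π a = a then 1 else 0) = fix π := by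
  have h : (if π a = a then 1 else 0) =
      ∑ i, if i = a then (if π i = i then 1 else 0) else 0 := by simp
  rw [fix, fix, Finset.card_filter, Finset.card_filter, Fin.sum_univ_castSucc, h,
    cycleInsert_some_last, if_neg (Fin.castSucc_lt_last _).ne, add_zero,
    ← Finset.sum_add_distrib]
  refine Finset.sum_congr rfl fun i _ => ?_
  by_cases hi : i = a
  · subst hi
    rw [cycleInsert_some_self, if_neg (Fin.castSucc_lt_last _).ne', if_pos rfl, zero_add]
  · rw [cycleInsert_some_of_ne π hi, if_neg hi]
    simp

/-- Whatever `a` was, it becomes an excedance; the new letter is never one. -/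
theorem exc_cycleInsert_some {n : ℕ} (π : Perm (Fin n)) (a : Fin n) :
    exc (cycleInsert π (some a)) + (if a < π a then 1 else 0) = exc π + 1 := by
  have h : (if a < π a then 1 else 0) =
      ∑ i, if i = a then (if i < π i then 1 else 0) else 0 := by simp
  have h1 : exc π + 1 = ∑ i, ((if π i > i then 1 else 0) + if i = a then 1 else 0) := by
    rw [Finset.sum_add_distrib, exc, Finset.card_filter, Finset.sum_ite_eq',
      if_pos (Finset.mem_univ a)]
  rw [h1, exc, Finset.card_filter, Fin.sum_univ_castSucc, h, cycleInsert_some_last,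
    if_neg (Fin.castSucc_lt_last _).not_gt, add_zero, ← Finset.sum_add_distrib]
  refine Finset.sum_congr rfl fun i _ => ?_
  by_cases hi : i = a
  · subst hi
    rw [cycleInsert_some_self, if_pos (Fin.castSucc_lt_last _), if_pos rfl, if_pos rfl, add_comm]
  · rw [cycleInsert_some_of_ne π hi, if_neg hi, if_neg hi]
    simp

/-- Number of cycle double descents: letters `a` with `π⁻¹ a > a > π a`. -/
def cdd {n : ℕ} (π : Perm (Fin n)) : ℕ :=
  (Finset.univ.filter fun a : Fin n => π a < a ∧ a < π⁻¹ a).card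

/-- Without double ascents a letter is fixed, a cycle valley, a cycle peak or a double descent.
Valleys are the excedances and peaks their images, so both number `exc π`. -/
theorem fix_add_exc_add_cdd {n : ℕ} {π : Perm (Fin n)} (h : cda π = 0) :
    fix π + 2 * exc π + cdd π = n := by
  have h0 : ∀ a, ¬ (π⁻¹ a < a ∧ a < π a) := fun a ha => by
    have := (cda_eq_zero_iff π).1 h (π⁻¹ a)
    simp only [apply_inv_self] at this
    exact this ha.1 ha.2
  have hexc : exc π = ∑ a, if π⁻¹ a < a then 1 else 0 := by
    rw [exc, Finset.card_filter, ← Equiv.sum_comp π⁻¹]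
    simp [-Finset.sum_boole]
  have hn : n = ∑ a : Fin n, 1 := by simp
  rw [two_mul]
  nth_rewrite 2 [hexc]
  conv_rhs => rw [hn]
  rw [fix, exc, cdd, Finset.card_filter, Finset.card_filter, Finset.card_filter,
    ← Finset.sum_add_distrib, ← Finset.sum_add_distrib, ← Finset.sum_add_distrib]
  refine Finset.sum_congr rfl fun a _ => ?_
  have h1 := h0 a
  have h2 : π⁻¹ a = a ↔ π a = a := by
    rw [Perm.inv_eq_iff_eq, eq_comm]
  rcases lt_trichotomy (π a) a with h3 | h3 | h3 <;>
    rcases lt_trichotomy (π⁻¹ a) a with h4 | h4 | h4 <;>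
    split_ifs <;> omega

-- Insertion is allowed after every letter except cycle peaks. A fixed point is traded for an
-- excedance, an excedance leaves both statistics unchanged, a double descent adds an excedance. A
-- general `Φ` serves both the counts and the weights.
open Classical in
theorem sum_simsun_succ {n : ℕ} {M : Type*} [AddCommMonoid M] (Φ : ℕ → ℕ → M) :
    (∑ σ : Perm (Fin (n + 1)), if IsSimsunSecond σ then Φ (fix σ) (exc σ) else 0) =
      ∑ π : Perm (Fin n), if IsSimsunSecond π then
        Φ (fix π + 1) (exc π) + (fix π • Φ (fix π - 1) (exc π + 1) + exc π • Φ (fix π) (exc π) +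
          cdd π • Φ (fix π) (exc π + 1)) else 0 := by
  rw [sum_perm_fin_succ]
  refine Finset.sum_congr rfl fun π _ => ?_
  simp only [isSimsunSecond_cycleInsert_none, isSimsunSecond_cycleInsert_some]
  by_cases h : IsSimsunSecond π
  swap
  · simp [h]
  simp only [h, true_and, if_true, fix_cycleInsert_none, exc_cycleInsert_none]
  congr 1
  have h0 := (cda_eq_zero_iff π).1 h.cda_eq_zero
  rw [fix, exc, cdd, ← Finset.sum_const, ← Finset.sum_const, ← Finset.sum_const,
    Finset.sum_filter, Finset.sum_filter, Finset.sum_filter, ← Finset.sum_add_distrib,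
    ← Finset.sum_add_distrib]
  refine Finset.sum_congr rfl fun a _ => ?_
  have hf := fix_cycleInsert_some π a
  have he := exc_cycleInsert_some π a
  have h2 : π⁻¹ a = a ↔ π a = a := by
    rw [Perm.inv_eq_iff_eq, eq_comm]
  change _ = (if π a = a then Φ (fix π - 1) (exc π + 1) else 0) +
    (if π a > a then Φ (fix π) (exc π) else 0) +
    (if π a < a ∧ a < π⁻¹ a then Φ (fix π) (exc π + 1) else 0)
  rcases lt_trichotomy (π a) a with h3 | h3 | h3
  · rw [if_neg h3.ne] at hf
    rw [if_neg h3.not_gt] at he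
    have h4 : ¬ π⁻¹ a < a ↔ a < π⁻¹ a := by
      rw [not_lt, le_iff_lt_or_eq, or_iff_left]
      exact fun h5 => h3.ne (h2.1 h5.symm)
    simp only [h4, h3, h3.ne, h3.not_gt, true_and, if_false, zero_add]
    rw [← hf, ← he, add_zero, add_zero]
  · rw [if_pos h3] at hf
    rw [if_neg (by simp [h3])] at he
    simp only [h2.2 h3, h3, lt_irrefl, not_false_eq_true, if_true, if_false,
      false_and, add_zero]
    rw [← hf, ← he, add_zero, Nat.add_sub_cancel]
  · rw [if_neg h3.ne'] at hf
    rw [if_pos h3] at he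
    have h4 : ¬ π⁻¹ a < a := fun h5 => by
      have := h0 (π⁻¹ a)
      rw [apply_inv_self] at this
      exact this h5 h3
    simp only [h4, h3, h3.ne', h3.not_gt, not_false_eq_true, false_and, if_true,
      if_false, add_zero, zero_add]
    rw [← hf, ← Nat.add_right_cancel he, add_zero]

end PermStat

/-! ### The γ-coefficients and the expansion of A -/

namespace PermStat
open Equiv

/-- Number of simsun permutations of the second kind with `i` fixed points and `j` excedances. -/
noncomputable def simsunCount (n : ℕ) (i j : ℤ) : ℤ :=
  Nat.card {π : Perm (Fin n) // IsSimsunSecond π ∧ (fix π : ℤ) = i ∧ (exc π : ℤ) = j}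

open Classical in
theorem simsunCount_eq_sum (n : ℕ) (i j : ℤ) :
    simsunCount n i j = ∑ π : Perm (Fin n), if IsSimsunSecond π then
      (if (fix π : ℤ) = i ∧ (exc π : ℤ) = j then 1 else 0) else 0 := by
  rw [simsunCount, Nat.card_eq_fintype_card, Fintype.card_subtype, Finset.card_filter,
    Nat.cast_sum]
  refine Finset.sum_congr rfl fun π _ => ?_
  by_cases h : IsSimsunSecond π <;> simp [h]

theorem simsunCount_zero (i j : ℤ) :
    simsunCount 0 i j = if (i, j) = (0, 0) then 1 else 0 := by
  rw [simsunCount_eq_sum, Fintype.sum_unique, if_pos (isSimsunSecond_zero _)]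
  simp [fix, exc, eq_comm]

theorem simsunCount_succ (n : ℕ) (i j : ℤ) :
    simsunCount (n + 1) i j = simsunCount n (i - 1) j + (1 + i) * simsunCount n (i + 1) (j - 1) +
      j * simsunCount n i j + (n - i - 2 * j + 2) * simsunCount n i (j - 1) := by
  classical
  simp only [simsunCount_eq_sum]
  rw [sum_simsun_succ fun f e => if (f : ℤ) = i ∧ (e : ℤ) = j then (1 : ℤ) else 0]
  simp only [Finset.mul_sum, ← Finset.sum_add_distrib]
  refine Finset.sum_congr rfl fun π _ => ?_
  by_cases h : IsSimsunSecond π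
  swap
  · simp [h]
  simp only [h, if_true]
  have hn := fix_add_exc_add_cdd h.cda_eq_zero
  generalize fix π = f at hn ⊢
  generalize exc π = e at hn ⊢
  generalize cdd π = d at hn ⊢
  have h1 : (if ((f + 1 : ℕ) : ℤ) = i ∧ (e : ℤ) = j then (1 : ℤ) else 0) =
      if (f : ℤ) = i - 1 ∧ (e : ℤ) = j then 1 else 0 :=
    if_congr (by omega) rfl rfl
  -- For f = 0 the subtraction truncates, but both sides vanish: on the right, f = i + 1 forces 1 +
  -- i = 0.
  have h2 : f • (if ((f - 1 : ℕ) : ℤ) = i ∧ ((e + 1 : ℕ) : ℤ) = j then (1 : ℤ) else 0) =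
      (1 + i) * if (f : ℤ) = i + 1 ∧ (e : ℤ) = j - 1 then 1 else 0 := by
    split_ifs <;> simp <;> omega
  have h3 : e • (if (f : ℤ) = i ∧ (e : ℤ) = j then (1 : ℤ) else 0) =
      j * if (f : ℤ) = i ∧ (e : ℤ) = j then 1 else 0 := by
    split_ifs <;> (simp; try omega)
  -- By `hn`, d = n - f - 2e, which is n - i - 2j + 2 when f = i and e = j - 1.
  have h4 : d • (if (f : ℤ) = i ∧ ((e + 1 : ℕ) : ℤ) = j then (1 : ℤ) else 0) =
      (n - i - 2 * j + 2) * if (f : ℤ) = i ∧ (e : ℤ) = j - 1 then 1 else 0 := by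
    split_ifs <;> simp <;> omega
  rw [h1, h2, h3, h4]
  ring

/-- The contribution of a simsun permutation of `[n]` with `f` fixed points and `e` excedances to
the expansion of `A (n + 1)`. -/
noncomputable def gammaWeight (n f e : ℕ) : Poly :=
  (s + y) ^ f * (2 * (x * y)) ^ e * (x + y) ^ (n - f - 2 * e)

/-- Since D(s+y) = D(x+y) = 2 and D(2xy) = 2(x+y), the operator xy D turns a factor s+y into 2xy, a
factor 2xy into 2xy(x+y), and a factor x+y into 2xy. These are the effects of inserting after a
fixed point, an excedance and a double descent. -/
theorem gammaWeight_recurrence {n f e d : ℕ} (h : f + 2 * e + d = n) :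
    (s + y) * gammaWeight n f e + x * y * diagDeriv (gammaWeight n f e) =
      gammaWeight (n + 1) (f + 1) e + (f • gammaWeight (n + 1) (f - 1) (e + 1) +
        e • gammaWeight (n + 1) f e + d • gammaWeight (n + 1) f (e + 1)) := by
  have h0 : gammaWeight n f e = (s + y) ^ f * (2 * (x * y)) ^ e * (x + y) ^ d := by
    rw [gammaWeight, show n - f - 2 * e = d by omega]
  have h1 : gammaWeight (n + 1) (f + 1) e =
      (s + y) ^ (f + 1) * (2 * (x * y)) ^ e * (x + y) ^ d := by
    rw [gammaWeight, show n + 1 - (f + 1) - 2 * e = d by omega]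
  -- The multiple is kept because at f = 0 the truncated f - 1 would give the wrong exponent of x +
  -- y.
  have h2 : f • gammaWeight (n + 1) (f - 1) (e + 1) =
      f • ((s + y) ^ (f - 1) * (2 * (x * y)) ^ (e + 1) * (x + y) ^ d) := by
    rcases f with - | f
    · simp
    · rw [gammaWeight, show n + 1 - (f + 1 - 1) - 2 * (e + 1) = d by omega]
  have h3 : gammaWeight (n + 1) f e = (s + y) ^ f * (2 * (x * y)) ^ e * (x + y) ^ (d + 1) := by
    rw [gammaWeight, show n + 1 - f - 2 * e = d + 1 by omega]
  have h4 : gammaWeight (n + 1) f (e + 1) =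
      (s + y) ^ f * (2 * (x * y)) ^ (e + 1) * (x + y) ^ (d - 1) := by
    rw [gammaWeight, show n + 1 - f - 2 * (e + 1) = d - 1 by omega]
  have hv : diagDeriv (2 * (x * y)) = 2 * (x + y) := by
    have : diagDeriv (2 : Poly) = 0 := diagDeriv.map_natCast 2
    simp only [Derivation.leibniz, this, diagDeriv_x, diagDeriv_y, smul_eq_mul]
    ring
  have hve : (x * y) * (e • (2 * (x * y)) ^ (e - 1) * (2 * (x + y))) =
      e • (2 * (x * y)) ^ e * (x + y) := by
    rcases e with - | e
    · simp
    · rw [Nat.add_sub_cancel, pow_succ]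
      simp only [nsmul_eq_mul]
      ring
  rw [h0, h1, h2, h3, h4]
  simp only [Derivation.leibniz, Derivation.leibniz_pow, hv, map_add, diagDeriv_x, diagDeriv_y,
    diagDeriv_s, smul_eq_mul, nsmul_eq_mul] at hve ⊢
  linear_combination (s + y) ^ f * (x + y) ^ d * hve

open Classical in
theorem A_succ_eq_sum_simsun (n : ℕ) :
    A (n + 1) = ∑ π : Perm (Fin n),
      if IsSimsunSecond π then gammaWeight n (fix π) (exc π) else 0 := by
  induction n with
  | zero =>
    rw [Fintype.sum_unique, if_pos (isSimsunSecond_zero _), A_one]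
    simp [gammaWeight, fix, exc]
  | succ n ih =>
    rw [A_succ_succ, ih, sum_simsun_succ, map_sum, Finset.mul_sum, Finset.mul_sum,
      ← Finset.sum_add_distrib]
    refine Finset.sum_congr rfl fun π _ => ?_
    by_cases h : IsSimsunSecond π
    · simp only [h, if_true]
      exact gammaWeight_recurrence (fix_add_exc_add_cdd h.cda_eq_zero)
    · simp [h]

theorem A_succ_eq_sum_simsunCount (n : ℕ) :
    A (n + 1) = ∑ i ∈ Finset.range (n + 1), (s + y) ^ i *
      ∑ j ∈ Finset.range ((n - i) / 2 + 1),
        2 ^ j * (simsunCount n i j : Poly) * (x * y) ^ j * (x + y) ^ (n - i - 2 * j) := by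
  classical
  have hterm : ∀ i j : ℕ, (s + y) ^ i *
      (2 ^ j * (simsunCount n i j : Poly) * (x * y) ^ j * (x + y) ^ (n - i - 2 * j)) =
      ∑ π : Perm (Fin n), if IsSimsunSecond π then
        (if fix π = i ∧ exc π = j then gammaWeight n (fix π) (exc π) else 0) else 0 := by
    intro i j
    have h1 : (s + y) ^ i *
        (2 ^ j * (simsunCount n i j : Poly) * (x * y) ^ j * (x + y) ^ (n - i - 2 * j)) =
        gammaWeight n i j * (simsunCount n i j : Poly) := by
      rw [gammaWeight, mul_pow]
      ring
    rw [h1, simsunCount_eq_sum, Int.cast_sum, Finset.mul_sum]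
    refine Finset.sum_congr rfl fun π _ => ?_
    by_cases h : IsSimsunSecond π
    · by_cases h2 : fix π = i ∧ exc π = j
      · simp [h, h2]
      · simp [h, h2]
    · simp [h]
  simp only [Finset.mul_sum, hterm]
  rw [A_succ_eq_sum_simsun, Finset.sum_congr rfl fun i _ => Finset.sum_comm, Finset.sum_comm]
  refine Finset.sum_congr rfl fun π _ => ?_
  by_cases h : IsSimsunSecond π
  swap
  · simp [h]
  have hn := fix_add_exc_add_cdd h.cda_eq_zero
  simp only [h, if_true]
  -- Each permutation contributes only at (fix, exc), which `hn` places inside the summation ranges.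
  rw [Finset.sum_eq_single (fix π), Finset.sum_eq_single (exc π), if_pos ⟨rfl, rfl⟩]
  · intro j _ hj
    rw [if_neg fun h2 => hj h2.2.symm]
  · intro hj
    rw [Finset.mem_range] at hj
    omega
  · intro i _ hi
    exact Finset.sum_eq_zero fun j _ => if_neg fun h2 => hi h2.1.symm
  · intro hi
    rw [Finset.mem_range] at hi
    omega

end PermStat

theorem theorem2p1 :
    -- the exponential generating function, in `ℚ(x, y, s)⟦z⟧`
    PermStat.egf =
      PermStat.expz (PermStat.y + PermStat.s) *
        (PermStat.const (PermStat.y - PermStat.x) *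
          (PermStat.const PermStat.y * PermStat.expz PermStat.x -
            PermStat.const PermStat.x * PermStat.expz PermStat.y)⁻¹) ^ 2 ∧
    ∃ γ : ℕ → ℤ → ℤ → ℤ,
      -- the expansion of `A_{n+1}(x, y, s)`, in `ℚ[x, y, s]`
      (∀ n : ℕ, PermStat.A (n + 1) =
        ∑ i ∈ Finset.range (n + 1), (PermStat.s + PermStat.y) ^ i *
          ∑ j ∈ Finset.range ((n - i) / 2 + 1),
            2 ^ j * (γ n i j : PermStat.Poly) * (PermStat.x * PermStat.y) ^ j *
              (PermStat.x + PermStat.y) ^ (n - i - 2 * j)) ∧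
      -- the initial conditions and the recurrence, for all integers `i` and `j`
      γ 0 0 0 = 1 ∧
      (∀ i j : ℤ, (i, j) ≠ (0, 0) → γ 0 i j = 0) ∧
      (∀ (n : ℕ) (i j : ℤ), γ (n + 1) i j =
        γ n (i - 1) j + (1 + i) * γ n (i + 1) (j - 1) + j * γ n i j +
          (n - i - 2 * j + 2) * γ n i (j - 1)) ∧
      -- the combinatorial interpretation
      (∀ (n : ℕ) (i j : ℤ), γ n i j =
        Nat.card {π : Equiv.Perm (Fin n) // PermStat.IsSimsunSecond π ∧
          (PermStat.fix π : ℤ) = i ∧ (PermStat.exc π : ℤ) = j}) := by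
  refine ⟨PermStat.egf_eq PermStat.A_succ_succ PermStat.A_one, PermStat.simsunCount,
    PermStat.A_succ_eq_sum_simsunCount, ?_, ?_, PermStat.simsunCount_succ, fun _ _ _ => rfl⟩
  · rw [PermStat.simsunCount_zero, if_pos rfl]
  · intro i j h
    rw [PermStat.simsunCount_zero, if_neg h]
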